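/- Let $K$ be an algebraically closed field and let $\Gamma$ be the quiver with vertices $e_i$ ($i\in\mathbb{Z}/4$) and eight arrows $a_{l,m}\colon e_m\to e_{m+1}$ ($l\in\mathbb{Z}/2$, $m\in\mathbb{Z}/4$). In the path algebra $K\Gamma$ (paths are written from left to right, and $e_i$ also denotes the trivial path at the vertex $e_i$) put $x_l=\sum_{m\in\mathbb{Z}/4}a_{l,m}$ for $l\in\mathbb{Z}/2$. For $q_0,q_1,q_2,q_3\in K\setminus\{0\}$ let $A=A_0(q_0,q_1,q_2,q_3)$ be the quotient of $K\Gamma$ by the two-sided ideal generated by the elements $$x_lx_{l+1}\quad(l\in\mathbb{Z}/2),\qquad e_i\bigl(q_ix_i^{2}+x_{i+1}^{2}\bigr)\quad(i\in\mathbb{Z}/4),$$ where the subscripts of $x$ are read modulo $2$. Then, for all nonzero $q_0,q_1,q_2,q_3$, the algebra $A$ is a self-injective Koszul algebra. That is: 1. $A$ is finite-dimensional over $K$, and it is injective as a right and as a left module over itself; 2. $A$ is graded by path length, $A=\bigoplus_{k\ge0}A_k$ with $A_k$ the image of the span of the paths of length $k$; its degree-zero part $A_0$ is semisimple; and, with $\operatorname{rad}A$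 the Jacobson radical of $A$, the graded right $A$-module $A/\operatorname{rad}A$ has a linear resolution, i.e. an exact sequence $\cdots\to P^2\to P^1\to P^0\to A/\operatorname{rad}A\to0$ of graded right $A$-modules and degree-$0$ homomorphisms in which each $P^n$ is projective and generated in degree $n$. -/

import Mathlib

open MulOpposite

universe u v w

noncomputable section

/-! ### Path algebras -/

/-- The path algebra `K Q` of a quiver `Q` with vertex set `V`: the `K`-vector space with basis all
(oriented) paths, the trivial paths included. -/
def PathAlgebra (K : Type u) [Field K] (V : Type v) [Quiver.{w} V] : Type (max u v w) :=
  (Σ a b : V, Quiver.Path a b) →₀ K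

namespace PathAlgebra

section Basic

variable (K : Type u) [Field K] {V : Type v} [Quiver.{w} V]

instance : AddCommGroup (PathAlgebra K V) :=
  inferInstanceAs (AddCommGroup ((Σ a b : V, Quiver.Path a b) →₀ K))

instance : Module K (PathAlgebra K V) :=
  inferInstanceAs (Module K ((Σ a b : V, Quiver.Path a b) →₀ K))

/-- The basis of the path algebra that consists of all paths. -/
def pathBasis (V : Type v) [Quiver.{w} V] :
    Module.Basis (Σ a b : V, Quiver.Path a b) K (PathAlgebra K V) :=
  Module.Basis.ofRepr (LinearEquiv.refl K ((Σ a b : V, Quiver.Path a b) →₀ K))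

/-- The basis element of the path algebra given by a path. -/
def ofPath {a b : V} (p : Quiver.Path a b) : PathAlgebra K V := pathBasis K V ⟨a, b, p⟩

/-- The trivial path `e_a` at the vertex `a`. -/
def vertex (a : V) : PathAlgebra K V := ofPath K (Quiver.Path.nil : Quiver.Path a a)

/-- An arrow, as an element of the path algebra. -/
def arrow {a b : V} (f : a ⟶ b) : PathAlgebra K V := ofPath K f.toPath

/-- The linear span of the paths of length `n`. -/
def lengthComponent (V : Type v) [Quiver.{w} V] (n : ℕ) : Submodule K (PathAlgebra K V) :=
  Submodule.span K {x | ∃ (a b : V) (p : Quiver.Path a b), p.length = n ∧ x = ofPath K p}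

@[elab_as_elim]
theorem induction_on {P : PathAlgebra K V → Prop} (x : PathAlgebra K V) (h0 : P 0)
    (hadd : ∀ x y, P x → P y → P (x + y))
    (hpath : ∀ (c : K) {a b : V} (p : Quiver.Path a b), P (c • ofPath K p)) : P x := by
  rw [← (pathBasis K V).linearCombination_repr x, Finsupp.linearCombination_apply, Finsupp.sum]
  exact Finset.sum_induction _ P hadd h0 fun p _ => hpath _ p.2.2

instance [Fintype V] : One (PathAlgebra K V) := ⟨∑ a : V, vertex K a⟩

theorem one_def [Fintype V] : (1 : PathAlgebra K V) = ∑ a : V, vertex K a := rfl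

end Basic

section Ring

variable (K : Type u) [Field K] {V : Type v} [Quiver.{w} V] [DecidableEq V]

/-- The product of two paths (written from left to right): their concatenation if the first one ends
where the second one starts, and `0` otherwise. -/
def pathMul (p q : Σ a b : V, Quiver.Path a b) : PathAlgebra K V :=
  if h : p.2.1 = q.1 then ofPath K ((p.2.2.cast rfl h).comp q.2.2) else 0

/-- The bilinear extension of `pathMul`. -/
def mulLin : PathAlgebra K V →ₗ[K] PathAlgebra K V →ₗ[K] PathAlgebra K V :=
  (pathBasis K V).constr K fun p => (pathBasis K V).constr K fun q => pathMul K p q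

instance : Mul (PathAlgebra K V) := ⟨fun x y => mulLin K x y⟩

theorem mul_def (x y : PathAlgebra K V) : x * y = mulLin K x y := rfl

theorem ofPath_mul_ofPath {a b c d : V} (p : Quiver.Path a b) (q : Quiver.Path c d) :
    ofPath K p * ofPath K q =
      if h : b = c then ofPath K ((p.cast rfl h).comp q) else 0 := by
  rw [mul_def, mulLin, ofPath, ofPath, Module.Basis.constr_basis, Module.Basis.constr_basis]
  rfl

theorem ofPath_mul_ofPath_same {a b c : V} (p : Quiver.Path a b) (q : Quiver.Path b c) :
    ofPath K p * ofPath K q = ofPath K (p.comp q) := by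
  rw [ofPath_mul_ofPath, dif_pos rfl]; rfl

theorem ofPath_mul_ofPath_ne {a b c d : V} (p : Quiver.Path a b) (q : Quiver.Path c d)
    (h : b ≠ c) : ofPath K p * ofPath K q = 0 := by
  rw [ofPath_mul_ofPath, dif_neg h]

theorem add_mul_aux (x y z : PathAlgebra K V) : (x + y) * z = x * z + y * z := by
  simp [mul_def]

theorem mul_add_aux (x y z : PathAlgebra K V) : x * (y + z) = x * y + x * z := by
  simp [mul_def]

theorem zero_mul_aux (x : PathAlgebra K V) : 0 * x = 0 := by simp [mul_def]

theorem mul_zero_aux (x : PathAlgebra K V) : x * 0 = 0 := by simp [mul_def]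

theorem smul_mul_aux (c : K) (x y : PathAlgebra K V) : (c • x) * y = c • (x * y) := by
  simp [mul_def]

theorem mul_smul_aux (c : K) (x y : PathAlgebra K V) : x * (c • y) = c • (x * y) := by
  simp [mul_def]

theorem mul_assoc_aux (x y z : PathAlgebra K V) : x * y * z = x * (y * z) := by
  induction x using induction_on with
  | h0 => simp only [zero_mul_aux]
  | hadd _ _ h₁ h₂ => simp only [add_mul_aux, h₁, h₂]
  | hpath c p =>
  induction y using induction_on with
  | h0 => simp only [zero_mul_aux, mul_zero_aux]
  | hadd _ _ h₁ h₂ => simp only [add_mul_aux, mul_add_aux, h₁, h₂]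
  | hpath c' p' =>
  induction z using induction_on with
  | h0 => simp only [mul_zero_aux]
  | hadd _ _ h₁ h₂ => simp only [mul_add_aux, h₁, h₂]
  | hpath c'' p'' =>
  rename_i a b a' b' a'' b''
  simp only [smul_mul_aux, mul_smul_aux]
  congr 3
  by_cases h : b = a'
  · subst h
    by_cases h' : b' = a''
    · subst h'
      simp only [ofPath_mul_ofPath_same, Quiver.Path.comp_assoc]
    · simp only [ofPath_mul_ofPath_same, ofPath_mul_ofPath_ne K _ _ h', mul_zero_aux]
  · by_cases h' : b' = a''
    · subst h'
      simp only [ofPath_mul_ofPath_same, ofPath_mul_ofPath_ne K _ _ h, zero_mul_aux]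
    · simp only [ofPath_mul_ofPath_ne K _ _ h, ofPath_mul_ofPath_ne K _ _ h', zero_mul_aux,
        mul_zero_aux]

variable [Fintype V]

theorem one_mul_aux (x : PathAlgebra K V) : 1 * x = x := by
  induction x using induction_on with
  | h0 => exact mul_zero_aux K 1
  | hadd _ _ h₁ h₂ => simp only [mul_add_aux, h₁, h₂]
  | hpath c p =>
  rename_i a b
  rw [mul_smul_aux]
  congr 1
  rw [mul_def, one_def, map_sum, LinearMap.sum_apply, Finset.sum_eq_single a]
  · rw [← mul_def, vertex, ofPath_mul_ofPath_same, Quiver.Path.nil_comp]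
  · intro a' _ h
    rw [← mul_def, vertex, ofPath_mul_ofPath_ne K _ _ h]
  · simp

theorem mul_one_aux (x : PathAlgebra K V) : x * 1 = x := by
  induction x using induction_on with
  | h0 => exact zero_mul_aux K 1
  | hadd _ _ h₁ h₂ => simp only [add_mul_aux, h₁, h₂]
  | hpath c p =>
  rename_i a b
  rw [smul_mul_aux]
  congr 1
  rw [mul_def, one_def, map_sum, Finset.sum_eq_single b]
  · rw [← mul_def, vertex, ofPath_mul_ofPath_same, Quiver.Path.comp_nil]
  · intro b' _ h
    rw [← mul_def, vertex, ofPath_mul_ofPath_ne K _ _ h.symm]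
  · simp

instance : Ring (PathAlgebra K V) :=
  { (inferInstance : AddCommGroup (PathAlgebra K V)) with
    mul := (· * ·)
    one := 1
    left_distrib := mul_add_aux K
    right_distrib := add_mul_aux K
    zero_mul := zero_mul_aux K
    mul_zero := mul_zero_aux K
    mul_assoc := mul_assoc_aux K
    one_mul := one_mul_aux K
    mul_one := mul_one_aux K }

instance : Algebra K (PathAlgebra K V) :=
  Algebra.ofModule (smul_mul_aux K) (fun c x y => mul_smul_aux K c x y)

end Ring

end PathAlgebra

/-! ### Self-injective algebras and Koszul algebras -/

/-- A self-injective `K`-algebra: a finite-dimensional algebra that is injective as a right module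
and as a left module over itself. Right `A`-modules are modules over `Aᵐᵒᵖ`. -/
structure IsSelfInjectiveAlgebra (K : Type u) [Field K] (A : Type u) [Ring A] [Algebra K A] :
    Prop where
  finiteDimensional : FiniteDimensional K A
  injective_right : Module.Injective Aᵐᵒᵖ A
  injective_left : Module.Injective A A

section Koszul

variable {K : Type u} [Field K] {A : Type u} [Ring A] [Algebra K A]

/-- `𝓟` is a grading of the right `A`-module `P` by `ℕ`, compatible with the grading `𝒜` of `A`:
`P = ⨁ₖ 𝓟 k`, and `𝓟 k · 𝒜 l ⊆ 𝓟 (k + l)`. -/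
structure IsGradedRightModule (𝒜 : ℕ → Submodule K A) {P : Type u} [AddCommGroup P]
    [Module Aᵐᵒᵖ P] (𝓟 : ℕ → AddSubgroup P) : Prop where
  isInternal : DirectSum.IsInternal 𝓟
  smul_mem : ∀ (k l : ℕ) (p : P) (a : A), p ∈ 𝓟 k → a ∈ 𝒜 l → op a • p ∈ 𝓟 (k + l)

/-- The right `A`-module `A / rad A`, where `rad A` is the Jacobson radical of `A`: the
intersection of all maximal right ideals. -/
abbrev TopOfAlgebra (A : Type u) [Ring A] : Type u := A ⧸ Module.jacobson Aᵐᵒᵖ A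

/-- The complex `⋯ → P 2 → P 1 → P 0 → A / rad A → 0` of right `A`-modules, with differentials
`d n : P (n + 1) → P n` and augmentation `ε`, is a linear resolution of `A / rad A` over the graded
algebra `A = ⨁ₖ 𝒜 k`: it is an exact sequence of graded modules and homomorphisms of degree `0`
(`A / rad A` has the grading induced from `A`), and `P n` is projective and generated in
degree `n`. -/
structure IsLinearResolution (𝒜 : ℕ → Submodule K A) (P : ℕ → Type u)
    [∀ n, AddCommGroup (P n)] [∀ n, Module Aᵐᵒᵖ (P n)] (𝓟 : ∀ n, ℕ → AddSubgroup (P n))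
    (d : ∀ n, P (n + 1) →ₗ[Aᵐᵒᵖ] P n) (ε : P 0 →ₗ[Aᵐᵒᵖ] TopOfAlgebra A) : Prop where
  projective : ∀ n, Module.Projective Aᵐᵒᵖ (P n)
  graded : ∀ n, IsGradedRightModule 𝒜 (𝓟 n)
  d_mem : ∀ n k, ∀ p ∈ 𝓟 (n + 1) k, d n p ∈ 𝓟 n k
  ε_mem : ∀ k, ∀ p ∈ 𝓟 0 k, ∃ a ∈ 𝒜 k, ε p = Submodule.Quotient.mk a
  exact : ∀ n, Function.Exact (d (n + 1)) (d n)
  exact_zero : Function.Exact (d 0) ε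
  surjective : Function.Surjective ε
  generated : ∀ n, Submodule.span Aᵐᵒᵖ (𝓟 n n : Set (P n)) = ⊤

/-- A (finite-dimensional) algebra `A` with a family `𝒜` of subspaces is a Koszul algebra:
`A = ⨁ₖ 𝒜 k` is a graded algebra, `𝒜 0` is a semisimple ring, and the right `A`-module `A / rad A`
has a linear resolution. If `A` is finite-dimensional and `𝒜 0` is semisimple then
`rad A = ⨁_{k ≥ 1} 𝒜 k`, so `A / rad A` is `𝒜 0` in degree `0`. -/
def IsKoszulAlgebra (𝒜 : ℕ → Submodule K A) : Prop :=
  FiniteDimensional K A ∧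
  (∃ _ : GradedAlgebra 𝒜, IsSemisimpleRing (𝒜 0)) ∧
  ∃ (P : ℕ → Type u) (_ : ∀ n, AddCommGroup (P n)) (_ : ∀ n, Module Aᵐᵒᵖ (P n))
    (𝓟 : ∀ n, ℕ → AddSubgroup (P n)) (d : ∀ n, P (n + 1) →ₗ[Aᵐᵒᵖ] P n)
    (ε : P 0 →ₗ[Aᵐᵒᵖ] TopOfAlgebra A), IsLinearResolution 𝒜 P 𝓟 d ε

end Koszul

/-! ### The quiver `Γ` and the algebras `A_T(q₀, q₁, q₂, q₃)` -/

/-- The vertices `e₀, e₁, e₂, e₃` of the quiver `Γ`. -/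
abbrev GammaVertex : Type := ZMod 4

/-- The arrows of `Γ`: for `l ∈ ℤ/2` and `m ∈ ℤ/4` an arrow `a_{l,m}` from `e_m` to `e_{m+1}`. -/
inductive GammaArrow : GammaVertex → GammaVertex → Type
  | a (l : ZMod 2) (m : GammaVertex) : GammaArrow m (m + 1)

instance gammaQuiver : Quiver GammaVertex := ⟨GammaArrow⟩

namespace Gamma

variable (K : Type u) [Field K]

/-- The path algebra `KΓ`. -/
abbrev KGamma : Type u := PathAlgebra K GammaVertex

/-- The trivial path `e_i`. -/
def e (i : ZMod 4) : KGamma K := PathAlgebra.vertex K (V := GammaVertex) i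

/-- `x_l = ∑_m a_{l,m}`. -/
def x (l : ZMod 2) : KGamma K :=
  ∑ m : ZMod 4, PathAlgebra.arrow K (V := GammaVertex) (GammaArrow.a l m)

/-- Reduction of subscripts from modulo `4` to modulo `2`. -/
def mod2 (i : ZMod 4) : ZMod 2 := ((i.val : ℕ) : ZMod 2)

variable {K}

/-- The generators `x_l x_{l+1}` and `e_i (q_i x_i^{4T+2} + x_{i+1}^{4T+2})` of
`I_T(q₀, q₁, q₂, q₃)`. -/
def relations (T : ℕ) (q : ZMod 4 → K) : Set (KGamma K) :=
  {r | ∃ l : ZMod 2, r = x K l * x K (l + 1)} ∪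
  {r | ∃ i : ZMod 4,
    r = e K i * (q i • x K (mod2 i) ^ (4 * T + 2) + x K (mod2 i + 1) ^ (4 * T + 2))}

/-- The two-sided ideal `I_T(q₀, q₁, q₂, q₃)` of `KΓ`. -/
def idealI (T : ℕ) (q : ZMod 4 → K) : TwoSidedIdeal (KGamma K) :=
  TwoSidedIdeal.span (relations T q)

/-- The algebra `A_T(q₀, q₁, q₂, q₃) = KΓ / I_T(q₀, q₁, q₂, q₃)`. -/
def AlgebraA (T : ℕ) (q : ZMod 4 → K) : Type u := KGamma K ⧸ (idealI T q).asIdeal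

instance (T : ℕ) (q : ZMod 4 → K) : Ring (AlgebraA T q) :=
  inferInstanceAs (Ring (KGamma K ⧸ (idealI T q).asIdeal))

instance (T : ℕ) (q : ZMod 4 → K) : Algebra K (AlgebraA T q) :=
  inferInstanceAs (Algebra K (KGamma K ⧸ (idealI T q).asIdeal))

/-- The canonical projection `KΓ → A_T(q₀, q₁, q₂, q₃)`. -/
def proj (T : ℕ) (q : ZMod 4 → K) : KGamma K →ₐ[K] AlgebraA T q :=
  Ideal.Quotient.mkₐ K (idealI T q).asIdeal

/-- The family of subspaces of `A_T(q₀, q₁, q₂, q₃)` given by path length: the `n`-th one is the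
image of the span of the paths of length `n`. -/
def lengthGrading (T : ℕ) (q : ZMod 4 → K) (n : ℕ) : Submodule K (AlgebraA T q) :=
  (PathAlgebra.lengthComponent K GammaVertex n).map (proj T q).toLinearMap

end Gamma

end

/-! Put $s_i=e_ix_i^2$. The relations say that $e_ix_l^2=t_l(i)s_i$ with $t_l(i)\in\{1,-q_i\}$, and
that products of different $x_l$ vanish. Since all $t_l(i)$ are nonzero, $s_i$ is a multiple of both
squares at $e_i$, so it is killed by every arrow. Hence the four $e_i$, the eight arrows and the
four $s_i$ span $A$. `Model` is the 16-dimensional algebra with this multiplication table in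
coordinates; `modelEquiv` identifies it with $A$, and the computations take place there.

Self-injectivity: the sum of the degree-two coefficients is a linear form that pairs vertices with
the $s_i$, and $a_{l,i}$ with $a_{l,i+1}$ with value $t_l(i)\ne0$. It is nondegenerate on both
sides, so Baer's criterion holds (`baer_self_of_frobeniusForm`).

Koszulness: take $P^n=A^{n+1}$, generated in degree $n$, and $(dp)_j=x_np_j+\alpha_nx_{n+1}p_{j+1}$
for functions $\alpha_n$ on the vertices. As $x_lx_{l+1}=0$, the condition $d^2=0$ reduces to
$\alpha_{n+1}(i+1)t_n(i)+\alpha_n(i)t_{n+1}(i)=0$. This determines $\alpha_n$ from $\alpha_0=1$,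
without zeros. Exactness is then solved degree by degree (`exact_of_coeff`). At $P^0$ it says that
$\operatorname{rad}A=x_0A+x_1A$ is the part of positive degree (`mem_jacobson_iff`). -/

/-- The regular right module of a ring is the regular module of the opposite ring. -/
def unopRightLinearEquiv (A : Type v) [Ring A] : Aᵐᵒᵖ ≃ₗ[Aᵐᵒᵖ] A :=
  { opAddEquiv.symm with map_smul' := fun _ _ => rfl }

/-! ### Frobenius forms and self-injectivity -/

/-- A finite-dimensional algebra with a linear form `t` for which `t (b * c) = 0` for all `b`
implies `c = 0` satisfies Baer's criterion as a left module over itself. -/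
theorem baer_self_of_frobeniusForm {K : Type u} [Field K] {A : Type v} [Ring A] [Algebra K A]
    [FiniteDimensional K A] (t : A →ₗ[K] K) (ht : ∀ c, (∀ b, t (b * c) = 0) → c = 0) :
    Module.Baer A A := by
  -- Nondegeneracy makes `c ↦ t (· * c)` an isomorphism onto the dual. The functional `t ∘ g`,
  -- extended from the ideal to `A`, is therefore `t (· * c)` for some `c`, and `g` turns out to be
  -- right multiplication by this `c`.
  let T : A →ₗ[K] Module.Dual K A := (LinearMap.mul K A).flip.compr₂ t
  have hT : ∀ c b, T c b = t (b * c) := fun _ _ => rfl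
  have hinj : Function.Injective T := by
    rw [injective_iff_map_eq_zero]
    exact fun c hc => ht c fun b => by rw [← hT, hc, LinearMap.zero_apply]
  have hsurj : Function.Surjective T :=
    (LinearMap.injective_iff_surjective_of_finrank_eq_finrank Subspace.dual_finrank_eq.symm).1 hinj
  intro I g
  obtain ⟨h, hh⟩ := LinearMap.exists_extend (p := I.restrictScalars K)
    (t ∘ₗ (g.restrictScalars K : I →ₗ[K] A))
  obtain ⟨c, rfl⟩ := hsurj h
  have key : ∀ (i : A) (hi : i ∈ I), t (i * c) = t (g ⟨i, hi⟩) := fun i hi =>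
    LinearMap.congr_fun hh ⟨i, hi⟩
  refine ⟨LinearMap.toSpanSingleton A A c, fun i hi => ?_⟩
  rw [LinearMap.toSpanSingleton_apply, smul_eq_mul, ← sub_eq_zero]
  refine ht _ fun b => ?_
  have hb : g ⟨b * i, I.mul_mem_left b hi⟩ = b * g ⟨i, hi⟩ := g.map_smul b ⟨i, hi⟩
  rw [mul_sub, map_sub, ← mul_assoc, key _ (I.mul_mem_left b hi), hb, sub_self]

/-- A finite-dimensional algebra with a linear form that is nondegenerate on both sides is
self-injective. -/
theorem isSelfInjectiveAlgebra_of_frobeniusForm {K : Type u} [Field K] {A : Type u} [Ring A]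
    [Algebra K A] [FiniteDimensional K A] (t : A →ₗ[K] K)
    (hl : ∀ c, (∀ b, t (b * c) = 0) → c = 0) (hr : ∀ c, (∀ b, t (c * b) = 0) → c = 0) :
    IsSelfInjectiveAlgebra K A where
  finiteDimensional := inferInstance
  injective_left := (baer_self_of_frobeniusForm t hl).injective
  injective_right := by
    -- The left-hand criterion for the opposite algebra, where the two nondegeneracy conditions
    -- trade places.
    have h : Module.Baer Aᵐᵒᵖ Aᵐᵒᵖ :=
      baer_self_of_frobeniusForm (t ∘ₗ (opLinearEquiv K (M := A)).symm.toLinearMap) fun c hc =>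
        unop_injective (hr _ fun b => hc (op b))
    exact (h.of_equiv (unopRightLinearEquiv A)).injective

/-! ### Gradings from projections -/

/-- A family of additive subgroups is a grading if there is a family of additive endomorphisms that
acts like the projections to the homogeneous components. -/
theorem DirectSum.isInternal_of_projections {ι M S : Type*} [DecidableEq ι] [AddCommGroup M]
    [SetLike S M] [AddSubgroupClass S M] (ℳ : ι → S) (π : ι → M →+ M)
    (mem : ∀ i m, π i m ∈ ℳ i) (same : ∀ i, ∀ m ∈ ℳ i, π i m = m)
    (ne : ∀ i j, j ≠ i → ∀ m ∈ ℳ j, π i m = 0) (s : Finset ι) (sum : ∀ m, ∑ i ∈ s, π i m = m) :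
    DirectSum.IsInternal ℳ := by
  -- The projections recover the components of a sum, which gives uniqueness of decompositions.
  have key : ∀ i (z : DirectSum ι fun i => ℳ i),
      π i (DirectSum.coeAddMonoidHom ℳ z) = z i := by
    intro i z
    induction z using DirectSum.induction_on with
    | zero => simp
    | of j m =>
      rw [DirectSum.coeAddMonoidHom_of]
      rcases eq_or_ne j i with rfl | h
      · rw [same _ _ m.2, DirectSum.of_eq_same]
      · rw [ne i j h _ m.2, DirectSum.of_eq_of_ne _ _ _ h.symm, ZeroMemClass.coe_zero]
    | add y z hy hz => rw [map_add, map_add, hy, hz, DirectSum.add_apply, AddMemClass.coe_add]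
  constructor
  · rw [injective_iff_map_eq_zero]
    intro z hz
    ext i
    rw [← key, hz, map_zero, DirectSum.zero_apply, ZeroMemClass.coe_zero]
  · intro m
    refine ⟨∑ i ∈ s, DirectSum.of (fun i => ℳ i) i ⟨π i m, mem i m⟩, ?_⟩
    simp only [map_sum, DirectSum.coeAddMonoidHom_of, sum]

noncomputable section

/-! ### The universal property of path algebras -/

namespace PathAlgebra

section Lift

variable {K : Type u} [Field K] {V : Type v} [Quiver.{w} V] {R : Type*} [Ring R] [Algebra K R]

/-- The product of the values of a family of elements along a path. -/
def pathValue (vert : V → R) (arr : ∀ {a b : V}, (a ⟶ b) → R) {a : V} :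
    ∀ {b : V}, Quiver.Path a b → R
  | _, .nil => vert a
  | _, .cons p f => pathValue vert arr p * arr f

variable (vert : V → R) (arr : ∀ {a b : V}, (a ⟶ b) → R)

theorem vert_mul_pathValue (vert_self : ∀ a, vert a * vert a = vert a) {a b : V}
    (p : Quiver.Path a b) : vert a * pathValue vert arr p = pathValue vert arr p := by
  induction p with
  | nil => exact vert_self a
  | cons p f ih => rw [pathValue, ← mul_assoc, ih]

theorem pathValue_mul_vert (vert_self : ∀ a, vert a * vert a = vert a)
    (arr_mul_vert : ∀ {a b : V} (f : a ⟶ b), arr f * vert b = arr f) {a b : V}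
    (p : Quiver.Path a b) : pathValue vert arr p * vert b = pathValue vert arr p := by
  cases p with
  | nil => exact vert_self a
  | cons p f => rw [pathValue, mul_assoc, arr_mul_vert]

variable [DecidableEq V] [Fintype V]

/-- The homomorphism from the path algebra given by orthogonal idempotents that sum to `1` and
elements for the arrows. -/
def lift (vert_self : ∀ a, vert a * vert a = vert a)
    (vert_ne : ∀ a b, a ≠ b → vert a * vert b = 0) (vert_sum : ∑ a, vert a = 1)
    (arr_mul_vert : ∀ {a b : V} (f : a ⟶ b), arr f * vert b = arr f) : PathAlgebra K V →ₐ[K] R :=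
  let L : PathAlgebra K V →ₗ[K] R :=
    (pathBasis K V).constr K fun p => pathValue vert arr p.2.2
  have hL : ∀ {a b : V} (p : Quiver.Path a b), L (ofPath K p) = pathValue vert arr p :=
    fun p => (pathBasis K V).constr_basis K _ _
  AlgHom.ofLinearMap L
    (by
      rw [one_def, map_sum, ← vert_sum]
      exact Finset.sum_congr rfl fun a _ => hL _)
    (by
      intro y z
      induction y using induction_on with
      | h0 => rw [zero_mul, map_zero, zero_mul]
      | hadd y₁ y₂ h₁ h₂ => rw [add_mul, map_add, h₁, h₂, map_add, add_mul]
      | hpath c p =>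
      induction z using induction_on with
      | h0 => rw [mul_zero, map_zero, mul_zero]
      | hadd y₁ y₂ h₁ h₂ => rw [mul_add, map_add, h₁, h₂, map_add, mul_add]
      | hpath c' p' =>
      rename_i a b a' b'
      simp only [smul_mul_assoc, mul_smul_comm, map_smul, hL]
      congr 2
      by_cases h : b = a'
      · subst h
        rw [ofPath_mul_ofPath_same, hL]
        induction p' with
        | nil => rw [Quiver.Path.comp_nil, pathValue, pathValue_mul_vert _ _ vert_self arr_mul_vert]
        | cons p' f ih => rw [Quiver.Path.comp_cons, pathValue, ih, mul_assoc, pathValue]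
      -- The paths do not meet: the idempotents at the end of `p` and the start of `p'` are
      -- inserted, and they are orthogonal.
      · rw [ofPath_mul_ofPath_ne K _ _ h, map_zero,
          ← pathValue_mul_vert _ _ vert_self arr_mul_vert p,
          ← vert_mul_pathValue _ _ vert_self p', mul_assoc, ← mul_assoc (vert b),
          vert_ne _ _ h, zero_mul, mul_zero])

@[simp]
theorem lift_ofPath (vert_self : ∀ a, vert a * vert a = vert a)
    (vert_ne : ∀ a b, a ≠ b → vert a * vert b = 0) (vert_sum : ∑ a, vert a = 1)
    (arr_mul_vert : ∀ {a b : V} (f : a ⟶ b), arr f * vert b = arr f) {a b : V}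
    (p : Quiver.Path a b) :
    lift (K := K) vert arr vert_self vert_ne vert_sum arr_mul_vert (ofPath K p) =
      pathValue vert arr p :=
  (pathBasis K V).constr_basis K _ _

end Lift

end PathAlgebra

/-! ### An explicit model of the algebra -/

namespace Gamma

theorem eq_zero_or_eq_one (l : ZMod 2) : l = 0 ∨ l = 1 := by
  revert l; decide

/-- The `K`-vector space with the elements `a + b₀ x₀ + b₁ x₁ + c s`, where `a`, `b₀`, `b₁`, `c` are
functions on the set of vertices of `Γ`. -/
@[ext]
structure Model (K : Type u) [Field K] (t : ZMod 2 → ZMod 4 → K) : Type u where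
  /-- The component of degree `0`. -/
  a : ZMod 4 → K
  /-- The component of degree `1`. -/
  b : ZMod 2 → ZMod 4 → K
  /-- The component of degree `2`. -/
  c : ZMod 4 → K

namespace Model

variable {K : Type u} [Field K] {t : ZMod 2 → ZMod 4 → K}

instance : Zero (Model K t) := ⟨⟨0, 0, 0⟩⟩
instance : One (Model K t) := ⟨⟨1, 0, 0⟩⟩
instance : Add (Model K t) := ⟨fun y z => ⟨y.a + z.a, y.b + z.b, y.c + z.c⟩⟩
instance : Neg (Model K t) := ⟨fun y => ⟨-y.a, -y.b, -y.c⟩⟩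
instance : SMul K (Model K t) := ⟨fun r y => ⟨r • y.a, r • y.b, r • y.c⟩⟩
/-- The product is determined by `x_l g = σ(g) x_l` with `σ(g) i = g (i + 1)`, `x_l x_{l+1} = 0`
and `x_l ^ 2 = t_l s`. -/
instance : Mul (Model K t) := ⟨fun y z =>
  ⟨fun i => y.a i * z.a i, fun l i => y.a i * z.b l i + y.b l i * z.a (i + 1),
    fun i => y.a i * z.c i + y.c i * z.a (i + 2) + t 0 i * (y.b 0 i * z.b 0 (i + 1)) +
      t 1 i * (y.b 1 i * z.b 1 (i + 1))⟩⟩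

@[simp] theorem zero_a : (0 : Model K t).a = 0 := rfl
@[simp] theorem zero_b : (0 : Model K t).b = 0 := rfl
@[simp] theorem zero_c : (0 : Model K t).c = 0 := rfl
@[simp] theorem one_a : (1 : Model K t).a = 1 := rfl
@[simp] theorem one_b : (1 : Model K t).b = 0 := rfl
@[simp] theorem one_c : (1 : Model K t).c = 0 := rfl
@[simp] theorem add_a (y z : Model K t) : (y + z).a = y.a + z.a := rfl
@[simp] theorem add_b (y z : Model K t) : (y + z).b = y.b + z.b := rfl
@[simp] theorem add_c (y z : Model K t) : (y + z).c = y.c + z.c := rfl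
@[simp] theorem neg_a (y : Model K t) : (-y).a = -y.a := rfl
@[simp] theorem neg_b (y : Model K t) : (-y).b = -y.b := rfl
@[simp] theorem neg_c (y : Model K t) : (-y).c = -y.c := rfl
@[simp] theorem smul_a (r : K) (y : Model K t) : (r • y).a = r • y.a := rfl
@[simp] theorem smul_b (r : K) (y : Model K t) : (r • y).b = r • y.b := rfl
@[simp] theorem smul_c (r : K) (y : Model K t) : (r • y).c = r • y.c := rfl
@[simp] theorem mul_a (y z : Model K t) (i : ZMod 4) : (y * z).a i = y.a i * z.a i := rfl
@[simp] theorem mul_b (y z : Model K t) (l : ZMod 2) (i : ZMod 4) :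
    (y * z).b l i = y.a i * z.b l i + y.b l i * z.a (i + 1) := rfl
@[simp] theorem mul_c (y z : Model K t) (i : ZMod 4) :
    (y * z).c i = y.a i * z.c i + y.c i * z.a (i + 2) + t 0 i * (y.b 0 i * z.b 0 (i + 1)) +
      t 1 i * (y.b 1 i * z.b 1 (i + 1)) := rfl

instance : AddCommGroup (Model K t) where
  add_assoc _ _ _ := by ext <;> simp [add_assoc]
  zero_add _ := by ext <;> simp
  add_zero _ := by ext <;> simp
  neg_add_cancel _ := by ext <;> simp
  add_comm _ _ := by ext <;> simp [add_comm]
  nsmul := nsmulRec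
  zsmul := zsmulRec

@[simp] theorem sum_a {ι : Type*} (s : Finset ι) (f : ι → Model K t) :
    (∑ i ∈ s, f i).a = ∑ i ∈ s, (f i).a :=
  map_sum (⟨⟨Model.a, rfl⟩, fun _ _ => rfl⟩ : Model K t →+ _) f s
@[simp] theorem sum_b {ι : Type*} (s : Finset ι) (f : ι → Model K t) :
    (∑ i ∈ s, f i).b = ∑ i ∈ s, (f i).b :=
  map_sum (⟨⟨Model.b, rfl⟩, fun _ _ => rfl⟩ : Model K t →+ _) f s
@[simp] theorem sum_c {ι : Type*} (s : Finset ι) (f : ι → Model K t) :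
    (∑ i ∈ s, f i).c = ∑ i ∈ s, (f i).c :=
  map_sum (⟨⟨Model.c, rfl⟩, fun _ _ => rfl⟩ : Model K t →+ _) f s

instance : Module K (Model K t) where
  one_smul _ := by ext <;> simp
  mul_smul _ _ _ := by ext <;> simp [mul_assoc]
  smul_zero _ := by ext <;> simp
  smul_add _ _ _ := by ext <;> simp [mul_add]
  add_smul _ _ _ := by ext <;> simp [add_mul]
  zero_smul _ := by ext <;> simp

instance : Ring (Model K t) :=
  { (inferInstance : AddCommGroup (Model K t)) with
    mul_assoc := fun y z w => by
      ext i
      · simp [mul_assoc]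
      · simp; ring
      · rename_i i
        have : i + 1 + 1 = i + 2 := by ring
        simp [this]; ring
    one_mul := fun _ => by ext <;> simp
    mul_one := fun _ => by ext <;> simp
    zero_mul := fun _ => by ext <;> simp
    mul_zero := fun _ => by ext <;> simp
    left_distrib := fun _ _ _ => by ext <;> simp <;> ring
    right_distrib := fun _ _ _ => by ext <;> simp <;> ring }

instance : Algebra K (Model K t) :=
  Algebra.ofModule (fun _ _ _ => by ext <;> simp <;> ring) (fun _ _ _ => by ext <;> simp <;> ring)

/-- The components of an element of the model, as a linear equivalence. -/
def components : Model K t ≃ₗ[K] (ZMod 4 → K) × (ZMod 2 → ZMod 4 → K) × (ZMod 4 → K) where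
  toFun y := (y.a, y.b, y.c)
  invFun p := ⟨p.1, p.2.1, p.2.2⟩
  map_add' _ _ := rfl
  map_smul' _ _ := rfl

instance : FiniteDimensional K (Model K t) :=
  Module.Finite.equiv (components (t := t)).symm

/-- The sum of the coefficients of degree `2`. -/
def frobeniusForm : Model K t →ₗ[K] K where
  toFun y := ∑ i, y.c i
  map_add' _ _ := by simp [Finset.sum_add_distrib]
  map_smul' _ _ := by simp [Finset.mul_sum]

theorem frobeniusForm_apply (y : Model K t) : frobeniusForm y = ∑ i, y.c i := rfl

/-- Each coordinate of `y` is isolated, up to a factor `t l i`, by one complementary basis element: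
the degree-two element at `i`, the arrow with the same `l` at the next vertex, or the idempotent at
`i + 2`, where the degree-two element starting at `i` ends. -/
theorem frobeniusForm_right_nondegenerate (ht : ∀ l i, t l i ≠ 0) (y : Model K t)
    (hy : ∀ z, frobeniusForm (y * z) = 0) : y = 0 := by
  simp only [frobeniusForm_apply] at hy
  ext i j
  · simpa [Pi.single_apply] using hy ⟨0, 0, Pi.single i 1⟩
  · have := hy ⟨0, fun l m => if l = i then if m = j + 1 then 1 else 0 else 0, 0⟩
    obtain rfl | rfl := eq_zero_or_eq_one i <;> simpa [Pi.single_apply, ht] using this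
  · simpa [Pi.single_apply] using hy ⟨Pi.single (i + 2) 1, 0, 0⟩

theorem frobeniusForm_left_nondegenerate (ht : ∀ l i, t l i ≠ 0) (y : Model K t)
    (hy : ∀ z, frobeniusForm (z * y) = 0) : y = 0 := by
  simp only [frobeniusForm_apply] at hy
  ext i j
  -- Multiplication from the left needs elements that end at `i`; those of degree two start at `i -
  -- 2`.
  · simpa [Pi.single_apply] using hy ⟨0, 0, Pi.single (i - 2) 1⟩
  · have := hy ⟨0, fun l m => if l = i then if m = j - 1 then 1 else 0 else 0, 0⟩
    obtain rfl | rfl := eq_zero_or_eq_one i <;> simpa [Pi.single_apply, ht] using this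
  · simpa [Pi.single_apply] using hy ⟨Pi.single i 1, 0, 0⟩

/-- The projection to the component of degree `k`. -/
def homogeneous (k : ℕ) : Model K t →ₗ[K] Model K t where
  toFun y := ⟨if k = 0 then y.a else 0, if k = 1 then y.b else 0, if k = 2 then y.c else 0⟩
  map_add' _ _ := by ext <;> dsimp <;> split_ifs <;> simp
  map_smul' _ _ := by ext <;> dsimp <;> split_ifs <;> simp

theorem homogeneous_apply (k : ℕ) (y : Model K t) : homogeneous k y =
    ⟨if k = 0 then y.a else 0, if k = 1 then y.b else 0, if k = 2 then y.c else 0⟩ := rfl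

theorem homogeneous_homogeneous (k l : ℕ) (y : Model K t) :
    homogeneous k (homogeneous l y) = if k = l then homogeneous k y else 0 := by
  ext <;> simp only [homogeneous_apply] <;> split_ifs <;> first | rfl | omega

theorem sum_homogeneous (y : Model K t) : ∑ k ∈ Finset.range 3, homogeneous k y = y := by
  rw [Finset.sum_range_succ, Finset.sum_range_succ, Finset.sum_range_one]
  ext <;> simp [homogeneous_apply]

theorem homogeneous_mul {k l : ℕ} {y z : Model K t} (hy : homogeneous k y = y)
    (hz : homogeneous l z = z) : homogeneous (k + l) (y * z) = y * z := by
  rw [← hy, ← hz]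
  ext i <;> simp only [homogeneous_apply, mul_a, mul_b, mul_c] <;>
  rcases k with _ | _ | _ | k <;> rcases l with _ | _ | _ | l <;> simp
  all_goals rw [if_neg (by omega)]; rfl

end Model

variable {K : Type u} [Field K]

/-! ### The isomorphism with the model -/

/-- The coefficients with `e_i x_l ^ 2 = t_l(i) e_i x_i ^ 2` in `A_0(q₀, q₁, q₂, q₃)`. -/
def squareCoeff (q : ZMod 4 → K) (l : ZMod 2) (i : ZMod 4) : K := if l = mod2 i then 1 else -q i

theorem squareCoeff_ne_zero {q : ZMod 4 → K} (hq : ∀ i, q i ≠ 0) (l : ZMod 2) (i : ZMod 4) :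
    squareCoeff q l i ≠ 0 := by
  unfold squareCoeff
  split_ifs
  · exact one_ne_zero
  · exact neg_ne_zero.2 (hq i)

/-! ### Vertices, arrows and relations of the quiver in the model -/

namespace Model

variable {t : ZMod 2 → ZMod 4 → K}

/-- The idempotent of a vertex in the model. -/
def vert (t : ZMod 2 → ZMod 4 → K) (i : ZMod 4) : Model K t :=
  ⟨fun j => if j = i then 1 else 0, 0, 0⟩

/-- The element of the model given by an arrow. -/
def arr (t : ZMod 2 → ZMod 4 → K) : ∀ {i j : ZMod 4}, GammaArrow i j → Model K t
  | _, _, .a l m => ⟨0, fun l' m' => if l' = l then if m' = m then 1 else 0 else 0, 0⟩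

theorem arr_mul_vert (t : ZMod 2 → ZMod 4 → K) {i j : ZMod 4} (f : GammaArrow i j) :
    arr t f * vert t j = arr t f := by
  cases f
  ext <;> simp [vert, arr]
  exact fun h _ => h

/-- The element `x_l` of the model. -/
def gen (t : ZMod 2 → ZMod 4 → K) (l : ZMod 2) : Model K t :=
  ⟨0, fun l' _ => if l' = l then 1 else 0, 0⟩

/-- The homomorphism from the path algebra to the model. -/
def ofKGamma (t : ZMod 2 → ZMod 4 → K) : KGamma K →ₐ[K] Model K t :=
  PathAlgebra.lift (vert t) (fun f => arr t f)
    (fun i => by ext <;> simp [vert])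
    (fun i j h => by ext <;> simp [vert]; aesop)
    (by ext <;> simp [vert])
    (arr_mul_vert t)

theorem ofKGamma_e (i : ZMod 4) : ofKGamma t (e K i) = vert t i :=
  PathAlgebra.lift_ofPath ..

theorem ofKGamma_cons {i j k : GammaVertex} (p : Quiver.Path i j) (f : j ⟶ k) :
    ofKGamma t (PathAlgebra.ofPath K (p.cons f)) =
      ofKGamma t (PathAlgebra.ofPath K p) * arr t f := by
  simp only [ofKGamma, PathAlgebra.lift_ofPath, PathAlgebra.pathValue]

theorem ofKGamma_arrow (l : ZMod 2) (m : ZMod 4) :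
    ofKGamma t (PathAlgebra.arrow K (V := GammaVertex) (GammaArrow.a l m)) = arr t (.a l m) := by
  have h : ofKGamma t (PathAlgebra.arrow K (V := GammaVertex) (GammaArrow.a l m)) =
      vert t m * arr t (.a l m) := PathAlgebra.lift_ofPath ..
  rw [h]
  ext <;> simp [vert, arr]
  split_ifs <;> rfl

theorem ofKGamma_x (l : ZMod 2) : ofKGamma t (x K l) = gen t l := by
  rw [x, map_sum]
  simp only [ofKGamma_arrow]
  ext <;> simp [arr, gen]

/-- In degree two the second family comes down to `q i * 1 + (-q i) = 0`, whence the sign in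
`squareCoeff`. -/
theorem relations_ofKGamma (q : ZMod 4 → K) (r : KGamma K) (hr : r ∈ relations 0 q) :
    ofKGamma (squareCoeff q) r = 0 := by
  rcases hr with ⟨l, rfl⟩ | ⟨i, rfl⟩
  · rw [map_mul, ofKGamma_x, ofKGamma_x]
    obtain rfl | rfl := eq_zero_or_eq_one l <;> ext <;> simp [gen]
  · simp only [map_mul, map_add, map_smul, ofKGamma_x, ofKGamma_e, mul_zero, zero_add,
      pow_two]
    have h : mod2 i = 0 ∨ mod2 i = 1 := eq_zero_or_eq_one _
    ext j
    · simp [vert, gen]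
    · simp [vert, gen]
    · by_cases hj : j = i
      · subst hj
        rcases h with h | h <;> simp [vert, gen, h, squareCoeff, show (1 : ZMod 2) + 1 = 0 from rfl]
      · simp [vert, hj]

end Model

/-- The homomorphism from the algebra to its model. -/
def toModel (q : ZMod 4 → K) : AlgebraA 0 q →ₐ[K] Model K (squareCoeff q) :=
  Ideal.Quotient.liftₐ (idealI 0 q).asIdeal (Model.ofKGamma (squareCoeff q)) fun r hr => by
    have h : idealI 0 q ≤ TwoSidedIdeal.ker (Model.ofKGamma (squareCoeff q)) :=
      TwoSidedIdeal.span_le.2 fun r hr =>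
        (TwoSidedIdeal.mem_ker _).2 (Model.relations_ofKGamma q r hr)
    exact (TwoSidedIdeal.mem_ker _).1 (h (TwoSidedIdeal.mem_asIdeal.1 hr))

theorem proj_surjective (q : ZMod 4 → K) : Function.Surjective (proj 0 q) :=
  Ideal.Quotient.mk_surjective

theorem proj_relation (q : ZMod 4 → K) {r : KGamma K} (hr : r ∈ relations 0 q) :
    proj 0 q r = 0 :=
  Ideal.Quotient.eq_zero_iff_mem.2 (TwoSidedIdeal.mem_asIdeal.2 (TwoSidedIdeal.subset_span hr))

/-- The image of a vertex in the algebra. -/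
def vertA (q : ZMod 4 → K) (i : ZMod 4) : AlgebraA 0 q := proj 0 q (e K i)

/-- The image of an arrow in the algebra. -/
def arrA (q : ZMod 4 → K) (l : ZMod 2) (m : ZMod 4) : AlgebraA 0 q :=
  proj 0 q (PathAlgebra.arrow K (V := GammaVertex) (GammaArrow.a l m))

/-- The element `e_i x_i ^ 2` of the algebra. -/
def socleA (q : ZMod 4 → K) (i : ZMod 4) : AlgebraA 0 q :=
  arrA q (mod2 i) i * arrA q (mod2 i) (i + 1)

/-! ### Multiplication table of the algebra -/

section

variable (q : ZMod 4 → K)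

theorem vertA_mul_arrA (i : ZMod 4) (l : ZMod 2) (m : ZMod 4) :
    vertA q i * arrA q l m = if i = m then arrA q l m else 0 := by
  rw [vertA, arrA, ← map_mul, e, PathAlgebra.vertex, PathAlgebra.arrow]
  split_ifs with h
  · subst h
    rw [PathAlgebra.ofPath_mul_ofPath_same, Quiver.Path.nil_comp]
  · rw [PathAlgebra.ofPath_mul_ofPath_ne K _ _ h, map_zero]

theorem arrA_mul_arrA_ne (l l' : ZMod 2) {i m : ZMod 4} (h : m ≠ i + 1) :
    arrA q l i * arrA q l' m = 0 := by
  rw [arrA, arrA, ← map_mul, PathAlgebra.arrow, PathAlgebra.arrow,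
    PathAlgebra.ofPath_mul_ofPath_ne K _ _ h.symm, map_zero]

theorem proj_x (l : ZMod 2) : proj 0 q (x K l) = ∑ m, arrA q l m := map_sum _ _ _

theorem vertA_mul_x (i : ZMod 4) (l : ZMod 2) : vertA q i * proj 0 q (x K l) = arrA q l i := by
  simp [proj_x, Finset.mul_sum, vertA_mul_arrA]

theorem arrA_mul_x (l l' : ZMod 2) (i : ZMod 4) :
    arrA q l i * proj 0 q (x K l') = arrA q l i * arrA q l' (i + 1) := by
  rw [proj_x, Finset.mul_sum]
  exact Finset.sum_eq_single _ (fun m _ h => arrA_mul_arrA_ne q l l' h) (by simp)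

theorem arrA_mul_arrA_succ (l : ZMod 2) (i : ZMod 4) :
    arrA q l i * arrA q (l + 1) (i + 1) = 0 := by
  rw [← arrA_mul_x, ← vertA_mul_x, mul_assoc, ← map_mul, proj_relation q (.inl ⟨l, rfl⟩), mul_zero]

theorem arrA_mul_arrA_self (l : ZMod 2) (i : ZMod 4) :
    arrA q l i * arrA q l (i + 1) = squareCoeff q l i • socleA q i := by
  unfold squareCoeff
  split_ifs with h
  · rw [one_smul, socleA, h]
  · have hl : l = mod2 i + 1 := by
      revert h; generalize mod2 i = l'; revert l l'; decide
    have key := proj_relation q (.inr ⟨i, rfl⟩)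
    simp only [mul_zero, zero_add, pow_two, map_mul, map_add, map_smul, mul_add,
      mul_smul_comm, ← mul_assoc] at key
    rw [← vertA, vertA_mul_x, vertA_mul_x, arrA_mul_x, arrA_mul_x] at key
    rw [hl, neg_smul, socleA]
    exact (neg_eq_of_add_eq_zero_right key).symm

theorem arrA_mul_arrA (l l' : ZMod 2) (i m : ZMod 4) :
    arrA q l i * arrA q l' m =
      if m = i + 1 then if l = l' then squareCoeff q l i • socleA q i else 0 else 0 := by
  split_ifs with h h'
  · rw [h, ← h', arrA_mul_arrA_self]
  · have hl : l' = l + 1 := by revert h'; revert l l'; decide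
    rw [h, hl, arrA_mul_arrA_succ]
  · exact arrA_mul_arrA_ne q l l' h

variable {q}

/-- A nonzero multiple of `socleA q i` is a product of two arrows of type `l + 1`, and the second of
them is killed by an arrow of type `l`. -/
theorem socleA_mul_arrA (hq : ∀ i, q i ≠ 0) (i : ZMod 4) (l : ZMod 2) (m : ZMod 4) :
    socleA q i * arrA q l m = 0 := by
  have key : squareCoeff q (l + 1) i • (socleA q i * arrA q l m) = 0 := by
    rw [← smul_mul_assoc, ← arrA_mul_arrA_self, mul_assoc, arrA_mul_arrA,
      if_neg (show ¬ l + 1 = l by revert l; decide), ite_self, mul_zero]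
  exact (smul_eq_zero.1 key).resolve_left (squareCoeff_ne_zero hq _ _)

/-- The linear map from the model to the algebra that is inverse to `toModel`. -/
def fromModel (q : ZMod 4 → K) : Model K (squareCoeff q) →ₗ[K] AlgebraA 0 q where
  toFun y := ∑ i, (y.a i • vertA q i + (y.b 0 i • arrA q 0 i + y.b 1 i • arrA q 1 i) +
    y.c i • socleA q i)
  map_add' y z := by
    rw [← Finset.sum_add_distrib]
    refine Finset.sum_congr rfl fun i _ => ?_
    simp only [Model.add_a, Model.add_b, Model.add_c, Pi.add_apply, add_smul]
    abel
  map_smul' r y := by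
    rw [Finset.smul_sum]
    refine Finset.sum_congr rfl fun i _ => ?_
    simp only [Model.smul_a, Model.smul_b, Model.smul_c, Pi.smul_apply, smul_add, smul_smul,
      smul_eq_mul, RingHom.id_apply]

theorem fromModel_apply (y : Model K (squareCoeff q)) : fromModel q y =
    ∑ i, (y.a i • vertA q i + (y.b 0 i • arrA q 0 i + y.b 1 i • arrA q 1 i) +
      y.c i • socleA q i) := rfl

/-- `fromModel` is only known to be linear; compatibility with arrows on the right is all that an
induction along paths requires. -/
theorem fromModel_mul_arr (hq : ∀ i, q i ≠ 0) (y : Model K (squareCoeff q)) (l : ZMod 2)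
    (m : ZMod 4) :
    fromModel q (y * Model.arr _ (.a l m)) = fromModel q y * arrA q l m := by
  have hm : ∀ i, (i + 1 = m) = (m = i + 1) := fun i => propext eq_comm
  simp only [fromModel_apply, Finset.sum_mul, add_mul, smul_mul_assoc, vertA_mul_arrA,
    arrA_mul_arrA, socleA_mul_arrA hq, Finset.sum_add_distrib]
  obtain rfl | rfl := eq_zero_or_eq_one l <;>
  simp [Model.arr, hm, smul_smul, mul_comm]

/-- This bounds the algebra from above: since `proj` is surjective, `fromModel` is a left inverse of
`toModel`, so no further relations hold in the model. -/
theorem fromModel_ofKGamma (hq : ∀ i, q i ≠ 0) (z : KGamma K) :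
    fromModel q (Model.ofKGamma (squareCoeff q) z) = proj 0 q z := by
  induction z using PathAlgebra.induction_on with
  | h0 => simp only [map_zero]
  | hadd y z hy hz => simp only [map_add, hy, hz]
  | hpath c p =>
    rename_i i j
    rw [map_smul, map_smul, map_smul]
    congr 1
    induction p with
    | nil =>
      have : Model.ofKGamma (squareCoeff q) (PathAlgebra.ofPath K .nil) =
        Model.vert (squareCoeff q) i := Model.ofKGamma_e i
      rw [this, fromModel_apply]
      simp [Model.vert]
      rfl
    | cons p f ih =>
      obtain ⟨l, m⟩ := f
      rw [Model.ofKGamma_cons, fromModel_mul_arr hq, ih, arrA, ← map_mul, PathAlgebra.arrow,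
        PathAlgebra.ofPath_mul_ofPath_same]
      rfl

theorem toModel_vertA (i : ZMod 4) : toModel q (vertA q i) = Model.vert _ i :=
  Model.ofKGamma_e i

theorem toModel_arrA (l : ZMod 2) (m : ZMod 4) :
    toModel q (arrA q l m) = Model.arr _ (.a l m) :=
  Model.ofKGamma_arrow l m

theorem toModel_socleA (i : ZMod 4) :
    toModel q (socleA q i) = ⟨0, 0, fun j => if j = i then 1 else 0⟩ := by
  have ht : squareCoeff q (mod2 i) i = 1 := if_pos rfl
  rw [socleA, map_mul, toModel_arrA, toModel_arrA]
  ext j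
  · simp [Model.arr]
  · simp [Model.arr]
  · by_cases hj : j = i
    · subst hj
      obtain h | h := eq_zero_or_eq_one (mod2 j) <;> rw [h] at ht <;> simp [Model.arr, h, ht]
    · simp [Model.arr, hj]

theorem toModel_surjective : Function.Surjective (toModel q) := by
  refine fun y => ⟨fromModel q y, ?_⟩
  simp only [fromModel_apply, map_sum, map_add, map_smul, toModel_vertA, toModel_arrA,
    toModel_socleA]
  ext l i
  · simp [Model.vert, Model.arr]
  · obtain rfl | rfl := eq_zero_or_eq_one l <;> simp [Model.vert, Model.arr]
  · simp [Model.vert, Model.arr]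

/-- The isomorphism between the algebra and its model. -/
def modelEquiv (hq : ∀ i, q i ≠ 0) : AlgebraA 0 q ≃ₐ[K] Model K (squareCoeff q) :=
  AlgEquiv.ofBijective (toModel q) <| by
    refine ⟨Function.LeftInverse.injective (g := fromModel q) fun z => ?_, toModel_surjective⟩
    obtain ⟨z, rfl⟩ := proj_surjective q z
    exact fromModel_ofKGamma hq z

theorem modelEquiv_proj (hq : ∀ i, q i ≠ 0) (z : KGamma K) :
    modelEquiv hq (proj 0 q z) = Model.ofKGamma (squareCoeff q) z := rfl

end

/-! ### The grading by path length -/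

section Grading

variable {q : ZMod 4 → K} (hq : ∀ i, q i ≠ 0)

theorem Model.homogeneous_ofKGamma (t : ZMod 2 → ZMod 4 → K) {i j : GammaVertex}
    (p : Quiver.Path i j) :
    homogeneous p.length (ofKGamma t (PathAlgebra.ofPath K p)) =
      ofKGamma t (PathAlgebra.ofPath K p) := by
  induction p with
  | nil =>
    have : ofKGamma t (PathAlgebra.ofPath K .nil) = vert t i := ofKGamma_e i
    rw [this]
    rfl
  | cons p f ih =>
    rw [ofKGamma_cons]
    obtain ⟨l, m⟩ := f
    exact homogeneous_mul ih rfl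

theorem mem_lengthGrading_iff (n : ℕ) (y : AlgebraA 0 q) :
    y ∈ lengthGrading 0 q n ↔ Model.homogeneous n (modelEquiv hq y) = modelEquiv hq y := by
  constructor
  · rintro ⟨z, hz, rfl⟩
    change Model.homogeneous n (Model.ofKGamma _ z) = Model.ofKGamma _ z
    induction hz using Submodule.span_induction with
    | mem z hz =>
      obtain ⟨i, j, p, rfl, rfl⟩ := hz
      exact Model.homogeneous_ofKGamma _ p
    | zero => simp only [map_zero]
    | add y z _ _ hy hz => simp only [map_add, hy, hz]
    | smul c z _ hz => simp only [map_smul, hz]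
  · intro h
    obtain ⟨z, rfl⟩ := proj_surjective q y
    -- Applied path by path to a preimage, the projection keeps the paths of length `n` and kills
    -- the others; by `h` it does not change the element.
    have key : (modelEquiv hq).symm (Model.homogeneous n (modelEquiv hq (proj 0 q z))) ∈
        lengthGrading 0 q n := by
      clear h
      induction z using PathAlgebra.induction_on with
      | h0 => simp only [map_zero, zero_mem]
      | hadd y z hy hz => simpa only [map_add] using add_mem hy hz
      | hpath c p =>
        simp only [map_smul]
        refine Submodule.smul_mem _ _ ?_
        rw [modelEquiv_proj, ← Model.homogeneous_ofKGamma, Model.homogeneous_homogeneous]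
        split_ifs with hn
        · rw [hn, Model.homogeneous_ofKGamma, ← modelEquiv_proj hq, AlgEquiv.symm_apply_apply]
          exact ⟨_, Submodule.subset_span ⟨_, _, p, rfl, rfl⟩, rfl⟩
        · rw [map_zero]
          exact zero_mem _
    rwa [h, AlgEquiv.symm_apply_apply] at key

theorem lengthGrading_gradedMonoid (hq : ∀ i, q i ≠ 0) : SetLike.GradedMonoid (lengthGrading 0 q) where
  one_mem := by
    rw [mem_lengthGrading_iff hq, map_one]
    rfl
  mul_mem k l y z hy hz := by
    rw [mem_lengthGrading_iff hq] at *
    rw [map_mul]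
    exact Model.homogeneous_mul hy hz

/-- The projection of the algebra to its component of degree `k`. -/
def lengthProj (k : ℕ) : AlgebraA 0 q →ₗ[K] AlgebraA 0 q :=
  (modelEquiv hq).symm.toLinearMap ∘ₗ Model.homogeneous k ∘ₗ (modelEquiv hq).toLinearMap

theorem modelEquiv_lengthProj (k : ℕ) (y : AlgebraA 0 q) :
    modelEquiv hq (lengthProj hq k y) = Model.homogeneous k (modelEquiv hq y) :=
  (modelEquiv hq).apply_symm_apply _

theorem lengthProj_mem (k : ℕ) (y : AlgebraA 0 q) : lengthProj hq k y ∈ lengthGrading 0 q k := by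
  rw [mem_lengthGrading_iff hq, modelEquiv_lengthProj, Model.homogeneous_homogeneous, if_pos rfl]

theorem lengthProj_same {k : ℕ} {y : AlgebraA 0 q} (hy : y ∈ lengthGrading 0 q k) :
    lengthProj hq k y = y := by
  apply (modelEquiv hq).injective
  rwa [modelEquiv_lengthProj, ← mem_lengthGrading_iff]

theorem lengthProj_ne {k l : ℕ} (h : l ≠ k) {y : AlgebraA 0 q} (hy : y ∈ lengthGrading 0 q l) :
    lengthProj hq k y = 0 := by
  apply (modelEquiv hq).injective
  rw [mem_lengthGrading_iff hq] at hy
  rw [modelEquiv_lengthProj, ← hy, Model.homogeneous_homogeneous, if_neg h.symm, map_zero]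

theorem sum_lengthProj (y : AlgebraA 0 q) : ∑ k ∈ Finset.range 3, lengthProj hq k y = y := by
  apply (modelEquiv hq).injective
  simp only [map_sum, modelEquiv_lengthProj, Model.sum_homogeneous]

theorem lengthGrading_isInternal (hq : ∀ i, q i ≠ 0) : DirectSum.IsInternal (lengthGrading 0 q) :=
  DirectSum.isInternal_of_projections _ (fun k => (lengthProj hq k).toAddMonoidHom)
    (lengthProj_mem hq) (fun _ _ => lengthProj_same hq) (fun _ _ h _ => lengthProj_ne hq h)
    (Finset.range 3) (sum_lengthProj hq)

/-- The grading of the algebra by path length. -/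
abbrev lengthGradedAlgebra : GradedAlgebra (lengthGrading 0 q) :=
  { lengthGrading_gradedMonoid hq, (lengthGrading_isInternal hq).chooseDecomposition with }

theorem isSemisimpleRing_lengthGrading_zero :
    letI := lengthGradedAlgebra hq
    IsSemisimpleRing (lengthGrading 0 q 0) := by
  let := lengthGradedAlgebra hq
  -- Degree-zero elements are functions on the vertices with pointwise product, so $A_0\cong K^4$.
  let f : lengthGrading 0 q 0 →+* (ZMod 4 → K) :=
    { toFun := fun y => (modelEquiv hq (y : AlgebraA 0 q)).a
      map_one' := by
        rw [SetLike.GradeZero.coe_one, map_one, Model.one_a]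
      map_mul' := fun y z => by
        rw [SetLike.GradeZero.coe_mul, map_mul]
        rfl
      map_zero' := by
        rw [ZeroMemClass.coe_zero, map_zero, Model.zero_a]
      map_add' := fun y z => by
        rw [AddMemClass.coe_add, map_add, Model.add_a] }
  have hf : Function.Bijective f := by
    constructor
    · rw [injective_iff_map_eq_zero]
      rintro ⟨y, hy⟩ (h : (modelEquiv hq y).a = 0)
      ext
      apply (modelEquiv hq).injective
      rw [mem_lengthGrading_iff hq] at hy
      rw [← hy, Model.homogeneous_apply, h, ZeroMemClass.coe_zero, map_zero]
      rfl
    · intro g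
      refine ⟨⟨(modelEquiv hq).symm ⟨g, 0, 0⟩, ?_⟩, ?_⟩
      · rw [mem_lengthGrading_iff hq, AlgEquiv.apply_symm_apply]
        rfl
      · change (modelEquiv hq ((modelEquiv hq).symm ⟨g, 0, 0⟩)).a = g
        rw [AlgEquiv.apply_symm_apply]
  exact (RingEquiv.ofBijective f hf).symm.isSemisimpleRing

end Grading

/-! ### The radical -/

/-- There is nothing in degree three, so `y` has cube zero and the geometric series stops. -/
theorem Model.exists_one_sub_mul_eq_one {t : ZMod 2 → ZMod 4 → K} {y : Model K t} (hy : y.a = 0) :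
    ∃ z, (1 - y) * z = 1 := by
  refine ⟨1 + y + y * y, ?_⟩
  have h : y * y * y = 0 := by ext <;> simp [hy]
  have : (1 - y) * (1 + y + y * y) = 1 - y * y * y := by noncomm_ring
  rw [this, h, sub_zero]

theorem mem_jacobson_iff {q : ZMod 4 → K} (hq : ∀ i, q i ≠ 0) (y : AlgebraA 0 q) :
    y ∈ Module.jacobson (AlgebraA 0 q)ᵐᵒᵖ (AlgebraA 0 q) ↔ (modelEquiv hq y).a = 0 := by
  rw [Module.jacobson, Submodule.mem_sInf]
  constructor
  · intro h
    ext i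
    -- The elements without `e_i`-component form a right ideal of codimension one, hence a maximal
    -- one.
    let N : Submodule (AlgebraA 0 q)ᵐᵒᵖ (AlgebraA 0 q) :=
      { carrier := {z | (modelEquiv hq z).a i = 0}
        add_mem' := fun {y z} hy hz => by
          simp only [Set.mem_ofPred_eq] at *
          rw [map_add, Model.add_a, Pi.add_apply, hy, hz, add_zero]
        zero_mem' := by simp
        smul_mem' := fun c z hz => by
          simp only [Set.mem_ofPred_eq] at *
          rw [← op_unop c, op_smul_eq_mul, map_mul, Model.mul_a, hz, zero_mul] }
    have hN : ∀ z, z ∈ N ↔ (modelEquiv hq z).a i = 0 := fun _ => Iff.rfl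
    refine h N ⟨fun hN' => ?_, fun N' hN' => ?_⟩
    · have : (1 : AlgebraA 0 q) ∈ N := hN' ▸ Submodule.mem_top
      rw [hN, map_one] at this
      exact one_ne_zero this
    · obtain ⟨z, hz, hz'⟩ := SetLike.exists_of_lt hN'
      rw [hN] at hz'
      rw [eq_top_iff]
      intro w _
      -- Scaled so that `z * c` and `w` have the same coefficient at `e_i`.
      let c : AlgebraA 0 q :=
        (modelEquiv hq).symm ⟨fun _ => ((modelEquiv hq z).a i)⁻¹ * (modelEquiv hq w).a i, 0, 0⟩
      have h₁ : z * c ∈ N' := N'.smul_mem (op c) hz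
      have h₂ : w - z * c ∈ N' := hN'.le <| by
        rw [hN, sub_eq_add_neg, map_add, map_neg, map_mul, AlgEquiv.apply_symm_apply]
        simp [hz']
      simpa using add_mem h₂ h₁
  · intro h N hN
    by_contra hy
    -- If `y ∉ N`, maximality gives `1 = z + y * c` with `z ∈ N`. Then `z = 1 - y * c` has a right
    -- inverse, which forces `N = ⊤`.
    have hlt : N < N ⊔ Submodule.span _ {y} :=
      left_lt_sup.2 fun h => hy (h (Submodule.mem_span_singleton_self y))
    have h1 : (1 : AlgebraA 0 q) ∈ N ⊔ Submodule.span _ {y} := hN.2 _ hlt ▸ Submodule.mem_top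
    obtain ⟨z, hz, w, hw, hzw⟩ := Submodule.mem_sup.1 h1
    obtain ⟨c, rfl⟩ := Submodule.mem_span_singleton.1 hw
    rw [← op_unop c, op_smul_eq_mul] at hzw
    obtain ⟨v, hv⟩ := Model.exists_one_sub_mul_eq_one (y := modelEquiv hq (y * c.unop))
      (by rw [map_mul]; ext i; simp [h])
    have hv' : z * (modelEquiv hq).symm v = 1 := by
      apply (modelEquiv hq).injective
      rw [eq_sub_of_add_eq hzw, map_mul, map_sub, map_one, AlgEquiv.apply_symm_apply, hv]
    have h1N : (1 : AlgebraA 0 q) ∈ N := hv' ▸ N.smul_mem (op ((modelEquiv hq).symm v)) hz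
    refine hN.1 (eq_top_iff.2 fun w _ => ?_)
    simpa using N.smul_mem (op w) h1N

/-! ### The linear resolution -/

namespace Model

variable {t : ZMod 2 → ZMod 4 → K}

/-- The element `g x_l` of the model, for a function `g` on the vertices. -/
def scaledGen (t : ZMod 2 → ZMod 4 → K) (g : ZMod 4 → K) (l : ZMod 2) : Model K t :=
  ⟨0, fun l' i => if l' = l then g i else 0, 0⟩

theorem scaledGen_mul (g : ZMod 4 → K) (l : ZMod 2) (y : Model K t) :
    scaledGen t g l * y = ⟨0, fun l' i => if l' = l then g i * y.a (i + 1) else 0,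
      fun i => t l i * (g i * y.b l (i + 1))⟩ := by
  obtain rfl | rfl := eq_zero_or_eq_one l <;> ext <;> simp [scaledGen]

theorem scaledGen_mul_scaledGen_ne (g h : ZMod 4 → K) {l l' : ZMod 2} (hl : l ≠ l') :
    scaledGen t g l * scaledGen t h l' = 0 := by
  rw [scaledGen_mul]
  ext <;> simp [scaledGen, hl]

theorem succ_ne (l : ZMod 2) : l + 1 ≠ l := by
  revert l; decide

theorem eq_or_eq_succ (l' l : ZMod 2) : l' = l ∨ l' = l + 1 := by
  revert l l'; decide

/-- The outer terms contain `x_l x_{l+1}` or `x_{l+1} x_l`. The coefficient of `v` is `x_l β x_l + α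
x_{l+1}²`; moving `β` past `x_l` shifts its argument by one, and `h` says that the sum is zero. -/
theorem complex_of_coeff {α β : ZMod 4 → K} {l : ZMod 2}
    (h : ∀ i, β (i + 1) * t l i + α i * t (l + 1) i = 0) (u v w : Model K t) :
    scaledGen t 1 l * (scaledGen t 1 (l + 1) * u + scaledGen t β l * v) +
      scaledGen t α (l + 1) * (scaledGen t 1 (l + 1) * v + scaledGen t β l * w) = 0 := by
  have key : scaledGen t 1 l * scaledGen t β l +
      scaledGen t α (l + 1) * scaledGen t 1 (l + 1) = 0 := by
    rw [scaledGen_mul, scaledGen_mul]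
    ext i
    · simp
    · simp [scaledGen]
    · simp only [scaledGen, add_c, Pi.add_apply, if_true, zero_c, Pi.zero_apply, Pi.one_apply]
      linear_combination h i
  simp only [mul_add, ← mul_assoc, scaledGen_mul_scaledGen_ne _ _ (succ_ne l),
    scaledGen_mul_scaledGen_ne _ _ (succ_ne l).symm, zero_mul, zero_add, add_zero, ← add_mul, key]

/-- In degree one the hypothesis kills the degree-zero parts of `p`; in degree two it links the
`x_l`-part of each entry to the `x_{l+1}`-part of the next (`hb`). This link is the compatibility
needed to choose `w`. -/
theorem exact_of_coeff (ht : ∀ l i, t l i ≠ 0) {α β : ZMod 4 → K} {l : ZMod 2}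
    (h : ∀ i, β (i + 1) * t l i + α i * t (l + 1) i = 0) (hα : ∀ i, α i ≠ 0) (hβ : ∀ i, β i ≠ 0)
    {n : ℕ} (p : Fin (n + 2) → Model K t)
    (hp : ∀ j : Fin (n + 1),
      scaledGen t 1 l * p j.castSucc + scaledGen t α (l + 1) * p j.succ = 0) :
    ∃ w : Fin (n + 3) → Model K t, ∀ j : Fin (n + 2),
      scaledGen t 1 (l + 1) * w j.castSucc + scaledGen t β l * w j.succ = p j := by
  simp only [scaledGen_mul] at hp
  have ha : ∀ j, (p j).a = 0 := by
    intro j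
    ext i
    induction j using Fin.lastCases with
    | last =>
      -- The last entry only occurs with the coefficient `α`, which must be cancelled.
      have := congrFun (congrFun (congrArg Model.b (hp (Fin.last n))) (l + 1)) (i - 1)
      simpa [succ_ne, hα] using this
    | cast j =>
      have := congrFun (congrFun (congrArg Model.b (hp j)) l) (i - 1)
      simpa [succ_ne, (succ_ne l).symm] using this
  have hb : ∀ (j : Fin (n + 1)) i, (p j.castSucc).b l i = β i * (p j.succ).b (l + 1) i := by
    intro j i
    have h₁ := congrFun (congrArg Model.c (hp j)) (i - 1)
    have h₂ := h (i - 1)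
    simp only [add_c, Pi.add_apply, Pi.one_apply, sub_add_cancel, one_mul, zero_c,
      Pi.zero_apply] at h₁ h₂
    refine mul_left_cancel₀ (ht l (i - 1)) ?_
    linear_combination h₁ - (p j.succ).b (l + 1) i * h₂
  -- The degree-zero part of `w j` produces the `x_{l+1}`-part of `p j`, and its degree-one part
  -- produces the degree-two part. The extra last entry `w₁` produces the `x_l`-part of the last `p
  -- j`; for the other `j`, `hb` shows that `w (j + 1)` already does so.
  let w₀ : Fin (n + 2) → Model K t := fun j =>
    ⟨fun i => (p j).b (l + 1) (i - 1),
      fun l' i => if l' = l + 1 then (p j).c (i - 1) / t (l + 1) (i - 1) else 0, 0⟩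
  let w₁ : Model K t := ⟨fun i => (p (Fin.last _)).b l (i - 1) / β (i - 1), 0, 0⟩
  have hsucc : ∀ j : Fin (n + 2), (∀ i, β i * ((Fin.snoc w₀ w₁ : Fin (n + 3) → Model K t)
      j.succ).a (i + 1) = (p j).b l i) ∧
      ∀ i, ((Fin.snoc w₀ w₁ : Fin (n + 3) → Model K t) j.succ).b l i = 0 := by
    intro j
    induction j using Fin.lastCases with
    | last =>
      rw [Fin.succ_last, Fin.snoc_last]
      exact ⟨fun i => by simp [w₁, mul_div_cancel₀, hβ], fun i => rfl⟩
    | cast j =>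
      rw [Fin.succ_castSucc, Fin.snoc_castSucc]
      exact ⟨fun i => by simp [w₀, hb], fun i => if_neg (succ_ne l).symm⟩
  refine ⟨Fin.snoc w₀ w₁, fun j => ?_⟩
  rw [Fin.snoc_castSucc, scaledGen_mul, scaledGen_mul]
  ext l' i
  · simp [ha]
  · obtain rfl | rfl := eq_or_eq_succ l' l
    · simp [(succ_ne l').symm, (hsucc j).1]
    · simp [succ_ne l, w₀]
  · simp [(hsucc j).2, w₀, mul_div_cancel₀, ht]

/-- Exactness at `P 0`. The degree-two part can be obtained from `x_0` alone. -/
theorem exists_eq_scaledGen_mul_add (ht : ∀ l i, t l i ≠ 0) {y : Model K t} (hy : y.a = 0) :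
    ∃ u v, scaledGen t 1 0 * u + scaledGen t 1 1 * v = y := by
  refine ⟨⟨fun i => y.b 0 (i - 1), fun l i => if l = 0 then y.c (i - 1) / t 0 (i - 1) else 0, 0⟩,
    ⟨fun i => y.b 1 (i - 1), 0, 0⟩, ?_⟩
  rw [scaledGen_mul, scaledGen_mul]
  ext l i
  · simp [hy]
  · obtain rfl | rfl := eq_zero_or_eq_one l <;> simp
  · simp [mul_div_cancel₀, ht]

/-- The coefficients of the differentials of the linear resolution. -/
def coeff (t : ZMod 2 → ZMod 4 → K) : ℕ → ZMod 4 → K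
  | 0 => 1
  | n + 1 => fun i => -(coeff t n (i - 1) * t ((n : ZMod 2) + 1) (i - 1)) / t n (i - 1)

theorem coeff_ne_zero (ht : ∀ l i, t l i ≠ 0) (n : ℕ) (i : ZMod 4) : coeff t n i ≠ 0 := by
  induction n generalizing i with
  | zero => exact one_ne_zero
  | succ n ih => exact div_ne_zero (neg_ne_zero.2 (mul_ne_zero (ih _) (ht _ _))) (ht _ _)

/-- The condition `h` for consecutive differentials; the recursion in `coeff` is this equation
solved for the next coefficient. -/
theorem coeff_relation (ht : ∀ l i, t l i ≠ 0) (n : ℕ) (i : ZMod 4) :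
    coeff t (n + 1) (i + 1) * t n i + coeff t n i * t ((n : ZMod 2) + 1) i = 0 := by
  simp only [coeff]
  rw [add_sub_cancel_right, div_mul_cancel₀ _ (ht _ _), neg_add_cancel]

end Model

/-! ### The resolution over the algebra and its grading -/

section Resolution

variable {q : ZMod 4 → K} (hq : ∀ i, q i ≠ 0)

/-- The element `g x_l` of the algebra, for a function `g` on the vertices. -/
def scaledGenA (g : ZMod 4 → K) (l : ZMod 2) : AlgebraA 0 q :=
  (modelEquiv hq).symm (Model.scaledGen _ g l)

theorem modelEquiv_scaledGenA (g : ZMod 4 → K) (l : ZMod 2) :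
    modelEquiv hq (scaledGenA hq g l) = Model.scaledGen _ g l :=
  (modelEquiv hq).apply_symm_apply _

theorem scaledGenA_mem (g : ZMod 4 → K) (l : ZMod 2) :
    scaledGenA hq g l ∈ lengthGrading 0 q 1 := by
  rw [mem_lengthGrading_iff hq, modelEquiv_scaledGenA]
  rfl

/-- The differential `(d p)_j = x_n p_j + α_n x_{n+1} p_{j+1}` of the linear resolution. -/
def differential (n : ℕ) :
    (Fin (n + 2) → AlgebraA 0 q) →ₗ[(AlgebraA 0 q)ᵐᵒᵖ] (Fin (n + 1) → AlgebraA 0 q) where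
  toFun p j := scaledGenA hq 1 n * p j.castSucc +
    scaledGenA hq (Model.coeff (squareCoeff q) n) ((n : ZMod 2) + 1) * p j.succ
  map_add' p p' := by
    ext j
    simp only [Pi.add_apply, mul_add]
    abel
  map_smul' c p := by
    ext j
    simp only [Pi.smul_apply, RingHom.id_apply, mul_smul_comm, smul_add]

theorem differential_apply (n : ℕ) (p : Fin (n + 2) → AlgebraA 0 q) (j : Fin (n + 1)) :
    differential hq n p j = scaledGenA hq 1 n * p j.castSucc +
      scaledGenA hq (Model.coeff (squareCoeff q) n) ((n : ZMod 2) + 1) * p j.succ := rfl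

theorem modelEquiv_differential (n : ℕ) (p : Fin (n + 2) → AlgebraA 0 q) (j : Fin (n + 1)) :
    modelEquiv hq (differential hq n p j) =
      Model.scaledGen _ 1 n * modelEquiv hq (p j.castSucc) +
      Model.scaledGen _ (Model.coeff (squareCoeff q) n) ((n : ZMod 2) + 1) *
        modelEquiv hq (p j.succ) := by
  rw [differential_apply, map_add, map_mul, map_mul, modelEquiv_scaledGenA, modelEquiv_scaledGenA]

/-- The two generators swap roles from each differential to the next. -/
theorem natCast_add_two (n : ℕ) : ((n + 1 : ℕ) : ZMod 2) + 1 = n := by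
  rw [Nat.cast_succ, add_assoc, show (1 : ZMod 2) + 1 = 0 from rfl, add_zero]

theorem differential_exact (n : ℕ) :
    Function.Exact (differential hq (n + 1)) (differential hq n) := by
  have ht := squareCoeff_ne_zero hq
  intro p
  constructor
  · intro hp
    obtain ⟨w, hw⟩ := Model.exact_of_coeff ht (Model.coeff_relation ht n)
      (Model.coeff_ne_zero ht n) (Model.coeff_ne_zero ht (n + 1)) (fun j => modelEquiv hq (p j))
      (fun j => by rw [← modelEquiv_differential, hp, Pi.zero_apply, map_zero])
    refine ⟨fun j => (modelEquiv hq).symm (w j), funext fun j => (modelEquiv hq).injective ?_⟩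
    rw [modelEquiv_differential, AlgEquiv.apply_symm_apply, AlgEquiv.apply_symm_apply,
      natCast_add_two, Nat.cast_succ, hw]
  · rintro ⟨w, rfl⟩
    refine funext fun j => (modelEquiv hq).injective ?_
    rw [modelEquiv_differential, modelEquiv_differential, modelEquiv_differential,
      natCast_add_two, Nat.cast_succ, Fin.succ_castSucc, Pi.zero_apply, map_zero]
    exact Model.complex_of_coeff (Model.coeff_relation ht n) _ _ _

/-- The augmentation of the linear resolution. -/
def augmentation (q : ZMod 4 → K) :
    (Fin 1 → AlgebraA 0 q) →ₗ[(AlgebraA 0 q)ᵐᵒᵖ] TopOfAlgebra (AlgebraA 0 q) :=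
  (Module.jacobson (AlgebraA 0 q)ᵐᵒᵖ (AlgebraA 0 q)).mkQ ∘ₗ LinearMap.proj 0

theorem augmentation_apply (p : Fin 1 → AlgebraA 0 q) :
    augmentation q p = Submodule.Quotient.mk (p 0) := rfl

theorem augmentation_exact : Function.Exact (differential hq 0) (augmentation q) := by
  have ht := squareCoeff_ne_zero hq
  intro p
  rw [augmentation_apply, Submodule.Quotient.mk_eq_zero, mem_jacobson_iff hq]
  constructor
  · intro hp
    obtain ⟨u, v, huv⟩ := Model.exists_eq_scaledGen_mul_add ht hp
    refine ⟨![(modelEquiv hq).symm u, (modelEquiv hq).symm v],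
      funext fun j => (modelEquiv hq).injective ?_⟩
    rw [modelEquiv_differential, Fin.fin_one_eq_zero j, ← huv]
    simp [Model.coeff]
  · rintro ⟨w, rfl⟩
    rw [modelEquiv_differential, Model.scaledGen_mul, Model.scaledGen_mul, Model.add_a, add_zero]

/-- The homogeneous elements of degree `k` in the algebra, with the grading shifted by `n`. -/
def shiftedGrading (q : ZMod 4 → K) (n k : ℕ) : AddSubgroup (AlgebraA 0 q) :=
  if n ≤ k then (lengthGrading 0 q (k - n)).toAddSubgroup else ⊥

theorem mem_shiftedGrading_add {n k : ℕ} {y : AlgebraA 0 q} :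
    y ∈ shiftedGrading q n (n + k) ↔ y ∈ lengthGrading 0 q k := by
  rw [shiftedGrading, if_pos (Nat.le_add_right n k), Nat.add_sub_cancel_left,
    Submodule.mem_toAddSubgroup]

theorem mem_shiftedGrading_of_lt {n k : ℕ} (h : k < n) {y : AlgebraA 0 q} :
    y ∈ shiftedGrading q n k ↔ y = 0 := by
  rw [shiftedGrading, if_neg (not_le.2 h), AddSubgroup.mem_bot]

/-- The homogeneous elements of degree `k` in a free module whose generators have degree `n`. -/
def freeGrading (q : ZMod 4 → K) (n k : ℕ) : AddSubgroup (Fin (n + 1) → AlgebraA 0 q) :=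
  AddSubgroup.pi Set.univ fun _ => shiftedGrading q n k

theorem mem_freeGrading {n k : ℕ} {p : Fin (n + 1) → AlgebraA 0 q} :
    p ∈ freeGrading q n k ↔ ∀ j, p j ∈ shiftedGrading q n k := by
  simp [freeGrading, AddSubgroup.mem_pi]

/-- The projection to the component of degree `k` in a free module whose generators have
degree `n`. -/
def freeProj (n k : ℕ) : (Fin (n + 1) → AlgebraA 0 q) →+ (Fin (n + 1) → AlgebraA 0 q) :=
  if n ≤ k then ((lengthProj hq (k - n)).compLeft (Fin (n + 1))).toAddMonoidHom else 0

theorem freeProj_add (n k : ℕ) (p : Fin (n + 1) → AlgebraA 0 q) (j : Fin (n + 1)) :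
    freeProj hq n (n + k) p j = lengthProj hq k (p j) := by
  rw [freeProj, if_pos (Nat.le_add_right n k), Nat.add_sub_cancel_left]
  rfl

theorem freeProj_of_lt {n k : ℕ} (h : k < n) (p : Fin (n + 1) → AlgebraA 0 q) :
    freeProj hq n k p = 0 := by
  rw [freeProj, if_neg (not_le.2 h), AddMonoidHom.zero_apply]

theorem freeGrading_isGradedRightModule (hq : ∀ i, q i ≠ 0) (n : ℕ) :
    IsGradedRightModule (lengthGrading 0 q) (freeGrading q n) where
  isInternal := by
    -- The algebra lives in degrees 0, 1, 2, so the shifted module lives in degrees `n`, `n + 1`, `n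
    -- + 2`.
    refine DirectSum.isInternal_of_projections _ (freeProj hq n) (fun k p => ?_)
      (fun k p hp => ?_) (fun k k' hk p hp => ?_) ((Finset.range 3).map (addLeftEmbedding n))
      (fun p => ?_)
    · rw [mem_freeGrading]
      intro j
      rcases lt_or_ge k n with h | h
      · rw [freeProj_of_lt hq h]
        exact zero_mem _
      · obtain ⟨k, rfl⟩ := Nat.exists_eq_add_of_le h
        rw [freeProj_add, mem_shiftedGrading_add]
        exact lengthProj_mem hq k _
    · rw [mem_freeGrading] at hp
      ext j
      rcases lt_or_ge k n with h | h
      · rw [freeProj_of_lt hq h, (mem_shiftedGrading_of_lt h).1 (hp j), Pi.zero_apply]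
      · obtain ⟨k, rfl⟩ := Nat.exists_eq_add_of_le h
        rw [freeProj_add, lengthProj_same hq (mem_shiftedGrading_add.1 (hp j))]
    · rw [mem_freeGrading] at hp
      ext j
      rcases lt_or_ge k n with h | h
      · rw [freeProj_of_lt hq h]
      · obtain ⟨k, rfl⟩ := Nat.exists_eq_add_of_le h
        rw [freeProj_add, Pi.zero_apply]
        rcases lt_or_ge k' n with h' | h'
        · rw [(mem_shiftedGrading_of_lt h').1 (hp j), map_zero]
        · obtain ⟨k', rfl⟩ := Nat.exists_eq_add_of_le h'
          exact lengthProj_ne hq (fun h => hk (by rw [h])) (mem_shiftedGrading_add.1 (hp j))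
    · ext j
      simp only [Finset.sum_map, addLeftEmbedding_apply, Finset.sum_apply, freeProj_add,
        sum_lengthProj]
  smul_mem k l p a hp ha := by
    rw [mem_freeGrading] at hp ⊢
    intro j
    rw [Pi.smul_apply, op_smul_eq_mul]
    rcases lt_or_ge k n with h | h
    · rw [(mem_shiftedGrading_of_lt h).1 (hp j), zero_mul]
      exact zero_mem _
    · obtain ⟨k, rfl⟩ := Nat.exists_eq_add_of_le h
      rw [add_assoc, mem_shiftedGrading_add]
      exact (lengthGrading_gradedMonoid hq).mul_mem (mem_shiftedGrading_add.1 (hp j)) ha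

theorem differential_mem (n k : ℕ) (p : Fin (n + 2) → AlgebraA 0 q)
    (hp : p ∈ freeGrading q (n + 1) k) : differential hq n p ∈ freeGrading q n k := by
  rw [mem_freeGrading] at hp ⊢
  intro j
  rw [differential_apply]
  rcases lt_or_ge k (n + 1) with h | h
  · rw [(mem_shiftedGrading_of_lt h).1 (hp _), (mem_shiftedGrading_of_lt h).1 (hp _), mul_zero,
      mul_zero, add_zero]
    exact zero_mem _
  · obtain ⟨k, rfl⟩ := Nat.exists_eq_add_of_le h
    -- Reading `n + 1 + k` as `n + (1 + k)`: the coefficients of degree one make up for the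
    -- generators dropping from degree `n + 1` to `n`.
    rw [add_assoc, mem_shiftedGrading_add]
    exact add_mem
      ((lengthGrading_gradedMonoid hq).mul_mem (scaledGenA_mem hq _ _)
        (mem_shiftedGrading_add.1 (hp _)))
      ((lengthGrading_gradedMonoid hq).mul_mem (scaledGenA_mem hq _ _)
        (mem_shiftedGrading_add.1 (hp _)))

theorem span_freeGrading (hq : ∀ i, q i ≠ 0) (n : ℕ) : Submodule.span (AlgebraA 0 q)ᵐᵒᵖ
    (freeGrading q n n : Set (Fin (n + 1) → AlgebraA 0 q)) = ⊤ := by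
  rw [eq_top_iff]
  intro p _
  have hp : p = ∑ j, op (p j) • (Pi.single j 1 : Fin (n + 1) → AlgebraA 0 q) := by
    ext j
    simp [Finset.sum_apply, Pi.single_apply]
  rw [hp]
  refine Submodule.sum_mem _ fun j _ => Submodule.smul_mem _ _ (Submodule.subset_span ?_)
  rw [SetLike.mem_coe, mem_freeGrading]
  intro j'
  refine mem_shiftedGrading_add (k := 0).2 ?_
  rw [Pi.single_apply]
  split_ifs
  · exact (lengthGrading_gradedMonoid hq).one_mem
  · exact zero_mem _

theorem isLinearResolution : IsLinearResolution (lengthGrading 0 q)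
    (fun n => Fin (n + 1) → AlgebraA 0 q) (freeGrading q) (differential hq) (augmentation q) where
  projective n := Module.Projective.of_equiv
    (LinearEquiv.piCongrRight fun _ : Fin (n + 1) => unopRightLinearEquiv (AlgebraA 0 q))
  graded := freeGrading_isGradedRightModule hq
  d_mem := differential_mem hq
  ε_mem k p hp := by
    refine ⟨p 0, ?_, augmentation_apply p⟩
    have := mem_freeGrading.1 hp 0
    rwa [← Nat.zero_add k, mem_shiftedGrading_add] at this
  exact := differential_exact hq
  exact_zero := augmentation_exact hq
  surjective y := by
    obtain ⟨a, rfl⟩ := Submodule.Quotient.mk_surjective _ y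
    exact ⟨fun _ => a, rfl⟩
  generated := span_freeGrading hq

end Resolution

end Gamma

end

theorem proposition2p2 {K : Type u} [Field K] [IsAlgClosed K] (q : ZMod 4 → K)
    (hq : ∀ i, q i ≠ 0) :
    IsSelfInjectiveAlgebra K (Gamma.AlgebraA 0 q) ∧
      IsKoszulAlgebra (Gamma.lengthGrading 0 q) := by
  have ht := Gamma.squareCoeff_ne_zero hq
  let φ := Gamma.modelEquiv hq
  have hfin : FiniteDimensional K (Gamma.AlgebraA 0 q) :=
    Module.Finite.equiv φ.symm.toLinearEquiv
  refine ⟨isSelfInjectiveAlgebra_of_frobeniusForm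
    (Gamma.Model.frobeniusForm ∘ₗ φ.toLinearMap) (fun y hy => ?_) (fun y hy => ?_), hfin,
    ⟨Gamma.lengthGradedAlgebra hq, Gamma.isSemisimpleRing_lengthGrading_zero hq⟩,
    _, _, _, _, _, _, Gamma.isLinearResolution hq⟩
  · refine (map_eq_zero_iff φ φ.injective).1
      (Gamma.Model.frobeniusForm_left_nondegenerate ht _ fun z => ?_)
    simpa using hy (φ.symm z)
  · refine (map_eq_zero_iff φ φ.injective).1
      (Gamma.Model.frobeniusForm_right_nondegenerate ht _ fun z => ?_)
    simpa using hy (φ.symm z)
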